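/- Theorem 1. Let $\mathbb S$ be a finite set, $P$ the transition matrix of a Markov chain on $\mathbb S$ with strictly positive invariant distribution $\mu$, reversible in the sense that $\mu_sP_{st}=\mu_tP_{ts}$ for all $s,t\in\mathbb S$. Let $1=\lambda_0>\lambda_1\ge\lambda_2\ge\dots$ be the eigenvalues of $P$, counted with multiplicity, and let $g=1-\lambda_1>0$ be the spectral gap. Let $f$ be a function from $\mathbb S$ to an $m$-dimensional real Euclidean space with scalar product $\langle\cdot,\cdot\rangle$ and norm $|\cdot|$ such that $\sum_s\mu_sf(s)=0$, $\|f\|_\infty:=\sup_s|f(s)|\le L$, and the principal variance $\sigma^2(f):=\sup_{|u|=1}\sum_s\mu_s\langle f(s),u\rangle^2$ is at most $\sigma^2$. Let $s_0,s_1,s_2,\dots$ be a Markov chain with transition matrix $P$ and initial distribution $\mu^{(0)}$ (the law of $s_0$), and put $S_N=\sum_{t=1}^Nf(s_t)$ and $\|\mu^{(0)}/\mu\|=\Bigl(\sum_s\mu_s\bigl(\mu^{(0)}_s/\mu_s\bigr)^2\Bigr)^{1/2}$. Then for every $\varepsilon>0$ and every $N$, $$\Pr\{|S_N|\ge\varepsilon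 N\}\le 3\,\|\mu^{(0)}/\mu\|\,2^{m/2}\exp\Bigl(-\frac{\varepsilon^2N}{8k}\Bigr),\qquad k=\sigma^2\Bigl(\frac12+\frac1g\Bigr)+L^2\,\frac{192}{125}\,\frac{g}{\log^2(1+g/2)},$$ and the same inequality holds with $k$ replaced by $$k'=\sigma^2\Bigl(\frac12+\frac1g\Bigr)+L^2\,\frac{192}{125\,\log^2(1+g/2)}.$$ (When $f=0$ and the constant in the exponent is $0$, the exponential factor is read as $1$.) -/

import Mathlib

open MeasureTheory

noncomputable section

namespace ReversibleChain

variable {S : Type*} [Fintype S]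

/-- Detailed balance: the matrix `P` is reversible with respect to the weights `μ`. -/
def IsReversible (P : Matrix S S ℝ) (μ : S → ℝ) : Prop :=
  ∀ s t, μ s * P s t = μ t * P t s

/-- `g` is the spectral gap of `P`: after one copy of the eigenvalue `1` has been removed from the
multiset of eigenvalues of `P` (counted with multiplicity), the largest remaining one is `1 - g`.
All eigenvalues of a reversible chain are real, so none of them is missed. -/
def IsSpectralGap [DecidableEq S] (P : Matrix S S ℝ) (g : ℝ) : Prop :=
  IsGreatest {x : ℝ | x ∈ P.charpoly.roots.erase 1} (1 - g)

/-- The norm `‖μ₀ / μ‖ = (E (μ₀(s) / μ(s)) ^ 2) ^ (1/2)`, where `s` has the law `μ`. -/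
def ratioNorm (μ₀ μ : S → ℝ) : ℝ :=
  Real.sqrt (∑ s, μ s * (μ₀ s / μ s) ^ 2)

/-- The supremum norm of a vector-valued function. -/
def supNorm {E : Type*} [NormedAddCommGroup E] (f : S → E) : ℝ :=
  ⨆ s, ‖f s‖

/-- The principal variance of `f` under the law `μ`: the supremum over all unit vectors `u` of
`E ⟪f(s), u⟫ ^ 2`. -/
def principalVariance {E : Type*} [NormedAddCommGroup E] [InnerProductSpace ℝ E]
    (μ : S → ℝ) (f : S → E) : ℝ :=
  ⨆ u : Metric.sphere (0 : E) 1, ∑ s, μ s * (inner ℝ (f s) (u : E)) ^ 2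

/-- `X 0, X 1, …` is a Markov chain with initial distribution `μ₀` and transition matrix `P`.
The Markov property is written without a division by the probability of the past. -/
structure IsMarkovChain {Ω : Type*} [MeasurableSpace Ω] [MeasurableSpace S]
    (Pr : Measure Ω) (X : ℕ → Ω → S) (μ₀ : S → ℝ) (P : Matrix S S ℝ) : Prop where
  measurable : ∀ n, Measurable (X n)
  initial : ∀ s, Pr.real {ω | X 0 ω = s} = μ₀ s
  step : ∀ (n : ℕ) (x : ℕ → S),
    Pr.real {ω | ∀ i ≤ n + 1, X i ω = x i} =
      Pr.real {ω | ∀ i ≤ n, X i ω = x i} * P (x n) (x (n + 1))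

end ReversibleChain

end

/-! The sum is controlled through its Laplace transform. For a direction `z`, the function `h = ⟪f,
z⟫` is centred and bounded by `a = L ‖z‖`, and the exponential moment of its path sum is a power of
the tilted kernel `P s t * exp (h t)`, which is symmetric on `ℓ²(μ e^h)`. The Poincaré inequality
(`quadraticForm_le`) bounds the form of `P` by a multiple of the identity plus a rank-one term.
Cauchy–Schwarz and the centring of `h` absorb that term (`quadraticForm_tilted_le`), so for `a ≤ g /
6` the tilted norm is at most `exp (6 a² / g)`. For larger `a` the trivial bound `exp (a n)` is
already good enough.

The moment is thus sub-Gaussian in `z`. Integrating over `z` against a Gaussian gives an exponential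
moment of `‖S_N‖²` at the price of `2 ^ (m / 2)` (`sum_mul_exp_sq_norm_le`), and Markov's inequality
yields the tail with constant `6 L² / g`. The `L²` terms of `k` and `k'` alone dominate this
constant (`six_mul_sq_div_le`). -/

namespace ReversibleChain

/-! ### Spectral gap and Poincaré inequality -/

section Spectral

variable {S : Type*} [Fintype S] [DecidableEq S] {P : Matrix S S ℝ} {μ : S → ℝ} {g : ℝ}

lemma mem_roots_charpoly_of_mulVec_eq {w : S → ℝ} {c : ℝ} (hw : w ≠ 0)
    (h : P.mulVec w = c • w) : c ∈ P.charpoly.roots := by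
  rw [Polynomial.mem_roots P.charpoly_monic.ne_zero, ← Matrix.charpoly_toLin',
    ← Module.End.hasEigenvalue_iff_isRoot_charpoly]
  exact Module.End.hasEigenvalue_of_hasEigenvector (x := w)
    ⟨Module.End.mem_eigenspace_iff.2 (by simpa using h), hw⟩

/-- The gap of a stochastic matrix is at most `2`, since no eigenvalue lies below `-1`. -/
lemma gap_le_two (hP : P ∈ Matrix.rowStochastic ℝ S) (hgap : IsSpectralGap P g) : g ≤ 2 := by
  have hmem : (1 - g) ∈ P.charpoly.roots := Multiset.mem_of_mem_erase hgap.1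
  rw [Polynomial.mem_roots P.charpoly_monic.ne_zero, ← Matrix.charpoly_toLin',
    ← Module.End.hasEigenvalue_iff_isRoot_charpoly] at hmem
  obtain ⟨w, hw, hw0⟩ := hmem.exists_hasEigenvector
  rw [Module.End.mem_eigenspace_iff, Matrix.toLin'_apply] at hw
  obtain ⟨i, hi⟩ := Function.ne_iff.1 hw0
  obtain ⟨s, -, hs⟩ := Finset.exists_max_image Finset.univ (fun s => |w s|) ⟨i, Finset.mem_univ i⟩
  have hpos : 0 < |w s| := (abs_pos.2 hi).trans_le (hs i (Finset.mem_univ i))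
  have hsum : |(1 - g) * w s| ≤ |w s| := by
    have h1 : (1 - g) * w s = ∑ t, P s t * w t := by
      simpa [Matrix.mulVec, dotProduct] using (congrFun hw s).symm
    calc |(1 - g) * w s| ≤ ∑ t, |P s t * w t| := h1 ▸ Finset.abs_sum_le_sum_abs _ _
      _ ≤ ∑ t, P s t * |w s| := Finset.sum_le_sum fun t _ => by
          rw [abs_mul, abs_of_nonneg (hP.1 s t)]
          exact mul_le_mul_of_nonneg_left (hs t (Finset.mem_univ t)) (hP.1 s t)
      _ = |w s| := by
          rw [← Finset.sum_mul, Matrix.sum_row_of_mem_rowStochastic hP, one_mul]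
  rw [abs_mul] at hsum
  have h2 : |1 - g| ≤ 1 := by
    by_contra! hlt
    nlinarith
  linarith [(abs_le.1 h2).1]

/-- An eigenvector of mean zero belongs to an eigenvalue that is at most `1 - g`. -/
lemma eigenvalue_le_of_mean_eq_zero (hP : P ∈ Matrix.rowStochastic ℝ S)
    (hμ : ∑ s, μ s = 1) (hgap : IsSpectralGap P g) {w : S → ℝ} (hw : w ≠ 0)
    (hmean : ∑ s, μ s * w s = 0) {c : ℝ} (h : P.mulVec w = c • w) : c ≤ 1 - g := by
  refine hgap.2 ?_
  by_cases hc : c = 1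
  · subst hc
    have hone : P.mulVec 1 = 1 := hP.2
    -- The mean separates `w` from the constants, so the eigenspace of `1` has dimension at least
    -- two. Hence `1` is at least a double root and survives the erasure of one copy.
    have hli : LinearIndependent ℝ ![(1 : S → ℝ), w] := by
      rw [LinearIndependent.pair_iff]
      intro a b hab
      have ha : a = 0 := by
        have := congrArg (fun v : S → ℝ => ∑ s, μ s * v s) hab
        simp only [Pi.add_apply, Pi.smul_apply, Pi.one_apply, smul_eq_mul, mul_add, mul_one,
          Finset.sum_add_distrib, mul_left_comm _ b, ← Finset.mul_sum, hmean, Pi.zero_apply,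
          mul_zero, add_zero, Finset.sum_const_zero] at this
        rwa [← Finset.sum_mul, hμ, one_mul] at this
      refine ⟨ha, ?_⟩
      rw [ha, zero_smul, zero_add] at hab
      exact (smul_eq_zero.1 hab).resolve_right hw
    have hmemE : ∀ i, ![(1 : S → ℝ), w] i ∈ Module.End.eigenspace (Matrix.toLin' P) 1 := by
      intro i
      rw [Module.End.mem_eigenspace_iff, Matrix.toLin'_apply]
      fin_cases i
      · simpa using hone
      · simpa using h
    have hli' : LinearIndependent ℝ
        (fun i => (⟨_, hmemE i⟩ : Module.End.eigenspace (Matrix.toLin' P) 1)) :=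
      LinearIndependent.of_comp (Module.End.eigenspace (Matrix.toLin' P) 1).subtype hli
    have hcard := hli'.fintype_card_le_finrank
    have hle := (Matrix.toLin' P).finrank_eigenspace_le 1
    rw [Matrix.charpoly_toLin', ← Polynomial.count_roots] at hle
    rw [Fintype.card_fin] at hcard
    show (1 : ℝ) ∈ P.charpoly.roots.erase 1
    rw [← Multiset.count_pos, Multiset.count_erase_self]
    omega
  · exact (Multiset.mem_erase_of_ne hc).2 (mem_roots_charpoly_of_mulVec_eq hw h)

/-- The Poincaré inequality of a reversible chain, as a bound for its quadratic form. -/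
lemma quadraticForm_le (hP : P ∈ Matrix.rowStochastic ℝ S) (hμ : ∑ s, μ s = 1)
    (hμpos : ∀ s, 0 < μ s) (hrev : IsReversible P μ) (hgap : IsSpectralGap P g) (φ : S → ℝ) :
    ∑ s, μ s * (φ s * ∑ t, P s t * φ t) ≤
      (1 - g) * ∑ s, μ s * φ s ^ 2 + g * (∑ s, μ s * φ s) ^ 2 := by
  set q : S → ℝ := fun s => √(μ s) with hq
  have hqpos : ∀ s, 0 < q s := fun s => Real.sqrt_pos.2 (hμpos s)
  have hqq : ∀ s, μ s = q s * q s := fun s => (Real.mul_self_sqrt (hμpos s).le).symm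
  have hmass : ∀ w : S → ℝ, ∑ s, μ s * ∑ t, P s t * w t = ∑ t, μ t * w t := by
    intro w
    simp_rw [Finset.mul_sum]
    rw [Finset.sum_comm]
    refine Finset.sum_congr rfl fun t _ => ?_
    simp_rw [← mul_assoc, hrev _ t]
    rw [← Finset.sum_mul, ← Finset.mul_sum, Matrix.sum_row_of_mem_rowStochastic hP, mul_one]
  -- Conjugation by `√μ` turns detailed balance into symmetry; the claim becomes positivity of `M`.
  let A : Matrix S S ℝ := fun s t => q s * P s t / q t
  let M : Matrix S S ℝ := (1 - g) • (1 : Matrix S S ℝ) - A + g • Matrix.vecMulVec q q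
  have hM : ∀ v s, M.mulVec v s =
      (1 - g) * v s - q s * ∑ t, P s t * (v t / q t) + g * (q s * ∑ t, q t * v t) := by
    intro v s
    simp only [M, Matrix.add_mulVec, Matrix.sub_mulVec, Matrix.smul_mulVec, Matrix.one_mulVec,
      Pi.add_apply, Pi.sub_apply, Pi.smul_apply, smul_eq_mul]
    simp only [A, Matrix.mulVec, dotProduct, Matrix.vecMulVec_apply, Finset.mul_sum]
    congr 2
    · congr 1
      funext t
      ring
    · funext t
      ring
  have hA : ∀ s t, A s t = A t s := by
    intro s t
    have h := hrev s t
    rw [hqq s, hqq t] at h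
    have h1 := (hqpos s).ne'
    have h2 := (hqpos t).ne'
    simp only [A]
    rw [div_eq_div_iff h2 h1]
    linarith
  have hherm : M.IsHermitian := by
    refine Matrix.IsHermitian.ext fun s t => ?_
    simp only [M, Matrix.add_apply, Matrix.sub_apply, Matrix.smul_apply, Matrix.vecMulVec_apply,
      smul_eq_mul, star_trivial, hA t s, Matrix.one_apply, eq_comm (a := t) (b := s),
      mul_comm (q t)]
  have hpsd : M.PosSemidef := by
    rw [hherm.posSemidef_iff_eigenvalues_nonneg]
    intro j
    by_contra! hneg
    change hherm.eigenvalues j < 0 at hneg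
    set κ := hherm.eigenvalues j with hκ
    set v : S → ℝ := ⇑(hherm.eigenvectorBasis j) with hv
    have hv0 : v ≠ 0 := by
      intro h0
      apply (hherm.eigenvectorBasis.orthonormal.ne_zero j)
      ext s
      exact congrFun h0 s
    have hev := hherm.mulVec_eigenvectorBasis j
    set w : S → ℝ := fun s => v s / q s with hw
    have hvw : ∀ s, v s = q s * w s := fun s => by
      simp only [hw]
      rw [mul_div_cancel₀ _ (hqpos s).ne']
    have hw0 : w ≠ 0 := by
      intro h0
      apply hv0
      ext s
      rw [hvw, h0]
      simp
    have hPw : ∀ s, ∑ t, P s t * w t = (1 - g - κ) * w s + g * ∑ t, μ t * w t := by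
      intro s
      have h1 := congrFun hev s
      rw [hM] at h1
      have h2 : ∑ t, q t * v t = ∑ t, μ t * w t :=
        Finset.sum_congr rfl fun t _ => by rw [hvw t, hqq t]; ring
      have h3 : q s * ((1 - g) * w s - ∑ t, P s t * w t + g * ∑ t, μ t * w t) =
          q s * (κ * w s) := by
        have h4 : (κ • v) s = κ * v s := rfl
        change _ = (κ • v) s at h1
        change (1 - g) * v s - q s * ∑ t, P s t * w t + g * (q s * ∑ t, q t * v t) = _ at h1
        rw [h4, h2, hvw s] at h1
        linarith
      have h5 := mul_left_cancel₀ (hqpos s).ne' h3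
      linarith
    -- Averaging the eigenvalue equation against the invariant `μ` cancels all but `κ` times the
    -- mean. As `κ < 0`, `w` has mean zero, so it is an eigenvector of `P` with eigenvalue `1 - g -
    -- κ > 1 - g`, which is impossible.
    have hc : κ * ∑ t, μ t * w t = 0 := by
      have h1 := hmass w
      simp_rw [hPw, mul_add, mul_left_comm (μ _) (1 - g - κ)] at h1
      rw [Finset.sum_add_distrib, ← Finset.mul_sum, ← Finset.sum_mul, hμ] at h1
      linarith
    have hc0 : ∑ t, μ t * w t = 0 := (mul_eq_zero.1 hc).resolve_left hneg.ne
    have := eigenvalue_le_of_mean_eq_zero hP hμ hgap hw0 hc0 (c := 1 - g - κ) (by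
      ext s
      simpa [Matrix.mulVec, dotProduct, hc0] using hPw s)
    linarith
  have hfin := hpsd.dotProduct_mulVec_nonneg (fun s => q s * φ s)
  simp only [dotProduct, hM, Pi.star_apply, star_trivial] at hfin
  have e1 : ∀ t, q t * φ t / q t = φ t := fun t => by
    rw [mul_comm, mul_div_cancel_right₀ _ (hqpos t).ne']
  have e2 : ∑ t, q t * (q t * φ t) = ∑ t, μ t * φ t :=
    Finset.sum_congr rfl fun t _ => by rw [hqq t]; ring
  simp_rw [e1, e2] at hfin
  have e3 : ∑ s, q s * φ s * ((1 - g) * (q s * φ s) - q s * ∑ t, P s t * φ t +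
      g * (q s * ∑ t, μ t * φ t)) = (1 - g) * ∑ s, μ s * φ s ^ 2 -
      ∑ s, μ s * (φ s * ∑ t, P s t * φ t) + g * (∑ s, μ s * φ s) ^ 2 := by
    rw [sq (∑ s, μ s * φ s), Finset.mul_sum, Finset.sum_mul, Finset.mul_sum,
      ← Finset.sum_sub_distrib, ← Finset.sum_add_distrib]
    refine Finset.sum_congr rfl fun s _ => ?_
    rw [hqq s]
    ring
  rw [e3] at hfin
  linarith

end Spectral

/-! ### Norm of the tilted kernel -/

section Tilting

variable {S : Type*} [Fintype S] {P : Matrix S S ℝ} {μ h : S → ℝ} {g a : ℝ}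

/-- The scalar inequality that linearizes the secular equation of the tilted kernel. -/
lemma gap_le_one_add_div_mul (hg : 0 < g) (hag : a ≤ g / 6) {x : ℝ} (hx : |x| ≤ a) :
    0 < Real.exp (6 * a ^ 2 / g) * Real.exp (-x) - (1 - g) ∧
      g ≤ (1 + x / g) * (Real.exp (6 * a ^ 2 / g) * Real.exp (-x) - (1 - g)) := by
  have hx' := abs_le.1 hx
  have hsq : x ^ 2 ≤ a ^ 2 := sq_le_sq' hx'.1 hx'.2
  set y := x / g with hy
  have hxy : x = g * y := by rw [hy, mul_div_cancel₀ _ hg.ne']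
  have hy1 : -(1 / 6) ≤ y := by rw [hy, le_div_iff₀ hg]; linarith
  have hy2 : y ≤ 1 / 6 := by rw [hy, div_le_iff₀ hg]; linarith
  -- From `exp u ≥ 1 + u` and `x² ≤ a²`. The second claim then follows from `(1 + y) (1 - y + 6 y²)
  -- = 1 + y² (5 + 6 y) ≥ 1`.
  have hexp : g * (1 - y + 6 * y ^ 2) ≤
      Real.exp (6 * a ^ 2 / g) * Real.exp (-x) - (1 - g) := by
    rw [← Real.exp_add]
    have h1 := Real.add_one_le_exp (6 * a ^ 2 / g + -x)
    have h2 : 6 * g * y ^ 2 ≤ 6 * a ^ 2 / g := by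
      rw [le_div_iff₀ hg]
      calc 6 * g * y ^ 2 * g = 6 * x ^ 2 := by rw [hxy]; ring
        _ ≤ 6 * a ^ 2 := by linarith
    rw [hxy] at h1 ⊢
    nlinarith
  have hpos : 0 < 1 - y + 6 * y ^ 2 := by nlinarith [sq_nonneg y]
  refine ⟨(mul_pos hg hpos).trans_le hexp, ?_⟩
  refine le_trans ?_ (mul_le_mul_of_nonneg_left hexp (by linarith))
  have : 0 ≤ y ^ 2 * (5 + 6 * y) := mul_nonneg (sq_nonneg y) (by linarith)
  nlinarith

/-- Moving the diagonal terms to the right leaves the weight `d`, and Cauchy–Schwarz reduces the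
rank-one term to `g * ∑ μ / d ≤ 1`. This holds because `g / d ≤ 1 + h / g` pointwise and `h` has
mean zero. -/
lemma quadraticForm_tilted_le (hμ : ∑ s, μ s = 1) (hμpos : ∀ s, 0 < μ s) (hg : 0 < g)
    (hag : a ≤ g / 6) (hmean : ∑ s, μ s * h s = 0) (hh : ∀ s, |h s| ≤ a) (φ : S → ℝ) :
    (1 - g) * ∑ s, μ s * φ s ^ 2 + g * (∑ s, μ s * φ s) ^ 2 ≤
      Real.exp (6 * a ^ 2 / g) * ∑ s, μ s * (Real.exp (-h s) * φ s ^ 2) := by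
  set d : S → ℝ := fun s => Real.exp (6 * a ^ 2 / g) * Real.exp (-h s) - (1 - g) with hd
  have hdpos : ∀ s, 0 < d s := fun s => (gap_le_one_add_div_mul hg hag (hh s)).1
  have hdle : ∀ s, g ≤ (1 + h s / g) * d s := fun s => (gap_le_one_add_div_mul hg hag (hh s)).2
  have hcs : (∑ s, μ s * φ s) ^ 2 ≤ (∑ s, μ s / d s) * ∑ s, μ s * d s * φ s ^ 2 := by
    refine Finset.sum_sq_le_sum_mul_sum_of_sq_le_mul _ (fun s _ => ?_) (fun s _ => ?_)
      (fun s _ => ?_)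
    · exact (div_pos (hμpos s) (hdpos s)).le
    · exact mul_nonneg (mul_pos (hμpos s) (hdpos s)).le (sq_nonneg _)
    · have := (hdpos s).ne'
      exact le_of_eq (by field_simp)
  have hsum : g * ∑ s, μ s / d s ≤ 1 := by
    calc g * ∑ s, μ s / d s = ∑ s, μ s * (g / d s) := by
          rw [Finset.mul_sum]
          exact Finset.sum_congr rfl fun s _ => by ring
      _ ≤ ∑ s, μ s * (1 + h s / g) := Finset.sum_le_sum fun s _ =>
          mul_le_mul_of_nonneg_left ((div_le_iff₀ (hdpos s)).2 (hdle s)) (hμpos s).le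
      _ = ∑ s, μ s + (∑ s, μ s * h s) / g := by
          rw [Finset.sum_div, ← Finset.sum_add_distrib]
          exact Finset.sum_congr rfl fun s _ => by ring
      _ = 1 := by rw [hμ, hmean, zero_div, add_zero]
  have hnn : 0 ≤ ∑ s, μ s * d s * φ s ^ 2 :=
    Finset.sum_nonneg fun s _ => mul_nonneg (mul_pos (hμpos s) (hdpos s)).le (sq_nonneg _)
  have hkey : g * (∑ s, μ s * φ s) ^ 2 ≤ ∑ s, μ s * d s * φ s ^ 2 := by
    calc g * (∑ s, μ s * φ s) ^ 2
        ≤ g * ((∑ s, μ s / d s) * ∑ s, μ s * d s * φ s ^ 2) :=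
          mul_le_mul_of_nonneg_left hcs hg.le
      _ = (g * ∑ s, μ s / d s) * ∑ s, μ s * d s * φ s ^ 2 := by ring
      _ ≤ 1 * ∑ s, μ s * d s * φ s ^ 2 := mul_le_mul_of_nonneg_right hsum hnn
      _ = _ := one_mul _
  have hexpand : ∑ s, μ s * d s * φ s ^ 2 =
      Real.exp (6 * a ^ 2 / g) * ∑ s, μ s * (Real.exp (-h s) * φ s ^ 2) -
        (1 - g) * ∑ s, μ s * φ s ^ 2 := by
    rw [Finset.mul_sum, Finset.mul_sum, ← Finset.sum_sub_distrib]
    exact Finset.sum_congr rfl fun s _ => by simp only [hd]; ring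
  linarith

/-- A bound for the quadratic form of the tilted kernel bounds its operator norm on the weighted
space `ℓ²(μ e^h)`, because the kernel is symmetric and has nonnegative entries. -/
lemma weightedNorm_tilted_le (hP : ∀ s t, 0 ≤ P s t) (hμpos : ∀ s, 0 < μ s)
    (hrev : IsReversible P μ) {Λ : ℝ} (hΛ : 0 < Λ)
    (hquad : ∀ φ : S → ℝ, ∑ s, μ s * (φ s * ∑ t, P s t * φ t) ≤
      Λ * ∑ s, μ s * (Real.exp (-h s) * φ s ^ 2)) (v : S → ℝ) :
    ∑ s, μ s * Real.exp (h s) * (∑ t, P s t * Real.exp (h t) * v t) ^ 2 ≤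
      Λ ^ 2 * ∑ s, μ s * Real.exp (h s) * v s ^ 2 := by
  let Q : (S → ℝ) → (S → ℝ) → ℝ := fun x y => ∑ s, ∑ t, μ s * P s t * (x s * y t)
  have hQ : ∀ x y, Q x y = ∑ s, μ s * (x s * ∑ t, P s t * y t) := fun x y => by
    simp only [Q, Finset.mul_sum]
    exact Finset.sum_congr rfl fun s _ => Finset.sum_congr rfl fun t _ => by ring
  have hQs : ∀ x y, Q x y = Q y x := fun x y => by
    simp only [Q]
    rw [Finset.sum_comm]
    exact Finset.sum_congr rfl fun s _ => Finset.sum_congr rfl fun t _ => by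
      rw [hrev t s]; ring
  let n : (S → ℝ) → ℝ := fun x => ∑ s, μ s * (Real.exp (-h s) * x s ^ 2)
  have hup : ∀ x, Q x x ≤ Λ * n x := fun x => hQ x x ▸ hquad x
  -- Passing to `|x|` bounds the form from below as well, so no separate control of negative
  -- eigenvalues is needed.
  have hlow : ∀ x, -Q x x ≤ Λ * n x := fun x => by
    calc -Q x x ≤ Q (fun s => |x s|) (fun s => |x s|) := by
          simp only [Q, ← Finset.sum_neg_distrib]
          refine Finset.sum_le_sum fun s _ => Finset.sum_le_sum fun t _ => ?_
          rw [← mul_neg, ← abs_mul]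
          exact mul_le_mul_of_nonneg_left (neg_le_abs _) (mul_nonneg (hμpos s).le (hP s t))
      _ ≤ Λ * n (fun s => |x s|) := hup _
      _ = Λ * n x := by simp only [n, sq_abs]
  have hpol : ∀ x y, 2 * Q x y ≤ Λ * (n x + n y) := fun x y => by
    have h1 := hup (fun s => x s + y s)
    have h2 := hlow (fun s => x s - y s)
    have h3 : Q (fun s => x s + y s) (fun s => x s + y s) -
        Q (fun s => x s - y s) (fun s => x s - y s) = 2 * Q x y + 2 * Q y x := by
      simp only [Q, Finset.mul_sum, ← Finset.sum_sub_distrib, ← Finset.sum_add_distrib]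
      exact Finset.sum_congr rfl fun s _ => Finset.sum_congr rfl fun t _ => by ring
    have h4 : n (fun s => x s + y s) + n (fun s => x s - y s) = 2 * (n x + n y) := by
      simp only [n, Finset.mul_sum, ← Finset.sum_add_distrib]
      exact Finset.sum_congr rfl fun s _ => by ring
    rw [hQs y x] at h3
    nlinarith
  set u : S → ℝ := fun s => ∑ t, P s t * Real.exp (h t) * v t with hu
  have hexp : ∀ s, Real.exp (-h s) * Real.exp (h s) = 1 := fun s => by
    rw [← Real.exp_add, neg_add_cancel, Real.exp_zero]
  have hn : ∀ (c : ℝ) (x : S → ℝ), n (fun s => c * (Real.exp (h s) * x s)) =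
      c ^ 2 * ∑ s, μ s * Real.exp (h s) * x s ^ 2 := fun c x => by
    simp only [n, Finset.mul_sum]
    refine Finset.sum_congr rfl fun s _ => ?_
    linear_combination (μ s * Real.exp (h s) * x s ^ 2 * c ^ 2) * hexp s
  -- With `u` the image of `v`, these test functions give `2 ‖u‖² ≤ ‖u‖² + Λ² ‖v‖²` after division
  -- by `Λ`. The factor `1` lets `hn` rewrite both.
  have hmain := hpol (fun s => 1 * (Real.exp (h s) * u s)) (fun s => Λ * (Real.exp (h s) * v s))
  rw [hn, hn, hQ] at hmain
  have hcross : ∑ s, μ s * (1 * (Real.exp (h s) * u s) *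
      ∑ t, P s t * (Λ * (Real.exp (h t) * v t))) =
      Λ * ∑ s, μ s * Real.exp (h s) * u s ^ 2 := by
    rw [Finset.mul_sum]
    refine Finset.sum_congr rfl fun s _ => ?_
    have : ∑ t, P s t * (Λ * (Real.exp (h t) * v t)) = Λ * u s := by
      simp only [hu, Finset.mul_sum]
      exact Finset.sum_congr rfl fun t _ => by ring
    rw [this]
    ring
  rw [hcross] at hmain
  have := le_of_mul_le_mul_left (a := Λ)
    (b := 2 * ∑ s, μ s * Real.exp (h s) * u s ^ 2)
    (c := 1 ^ 2 * (∑ s, μ s * Real.exp (h s) * u s ^ 2) +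
      Λ ^ 2 * ∑ s, μ s * Real.exp (h s) * v s ^ 2) (by linarith) hΛ
  linarith

end Tilting

/-! ### Path sums and exponential moments -/

section Paths

variable {S : Type*}

/-- Transfer-matrix identity. The vector `v` stays arbitrary because summing out the first state
replaces it by `Matrix.vecMul v M`. -/
lemma sum_path_prod [Fintype S] [DecidableEq S] (M : Matrix S S ℝ) (n : ℕ) (v : S → ℝ) :
    ∑ y : Fin (n + 1) → S, v (y 0) * ∏ i : Fin n, M (y i.castSucc) (y i.succ) =
      ∑ s, v s * (M ^ n).mulVec 1 s := by
  induction n generalizing v with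
  | zero =>
    rw [← (Equiv.funUnique (Fin 1) S).symm.sum_comp]
    simp
  | succ n ih =>
    rw [← (Fin.consEquiv fun _ : Fin (n + 2) => S).sum_comp, Fintype.sum_prod_type,
      Finset.sum_comm]
    have hvM : ∀ y : Fin (n + 1) → S,
        ∑ s, v s * (M s (y 0) * ∏ i : Fin n, M (y i.castSucc) (y i.succ)) =
          (Matrix.vecMul v M) (y 0) * ∏ i : Fin n, M (y i.castSucc) (y i.succ) := fun y => by
      simp only [Matrix.vecMul, dotProduct, Finset.sum_mul, mul_assoc]
    simp only [Fin.consEquiv_apply, Fin.cons_zero, Fin.prod_univ_succ, Fin.castSucc_zero,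
      Fin.cons_succ, ← Fin.succ_castSucc]
    simp_rw [hvM]
    rw [ih]
    change Matrix.vecMul v M ⬝ᵥ (M ^ n).mulVec 1 = v ⬝ᵥ (M ^ (n + 1)).mulVec 1
    rw [← Matrix.dotProduct_mulVec, Matrix.mulVec_mulVec, ← pow_succ']

/-- The weight that the chain with initial distribution `μ₀` gives to a path. -/
def pathWeight (μ₀ : S → ℝ) (P : Matrix S S ℝ) {n : ℕ} (y : Fin (n + 1) → S) : ℝ :=
  μ₀ (y 0) * ∏ i : Fin n, P (y i.castSucc) (y i.succ)

lemma pathWeight_nonneg {μ₀ : S → ℝ} {P : Matrix S S ℝ} (hμ₀ : ∀ s, 0 ≤ μ₀ s)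
    (hP : ∀ s t, 0 ≤ P s t) {n : ℕ} (y : Fin (n + 1) → S) : 0 ≤ pathWeight μ₀ P y :=
  mul_nonneg (hμ₀ _) (Finset.prod_nonneg fun _ _ => hP _ _)

lemma sum_pathWeight [Fintype S] [DecidableEq S] {μ₀ : S → ℝ} {P : Matrix S S ℝ} (hμ₀ : ∑ s, μ₀ s = 1)
    (hP : P ∈ Matrix.rowStochastic ℝ S) (n : ℕ) :
    ∑ y : Fin (n + 1) → S, pathWeight μ₀ P y = 1 := by
  simp only [pathWeight]
  rw [sum_path_prod, (pow_mem hP n : P ^ n ∈ Matrix.rowStochastic ℝ S).2]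
  simpa using hμ₀

lemma one_le_ratioNorm [Fintype S] {μ₀ μ : S → ℝ} (hμ₀ : ∑ s, μ₀ s = 1) (hμ : ∑ s, μ s = 1)
    (hμpos : ∀ s, 0 < μ s) : 1 ≤ ratioNorm μ₀ μ := by
  rw [ratioNorm, Real.one_le_sqrt]
  have h := Finset.sum_sq_le_sum_mul_sum_of_sq_le_mul Finset.univ (r := μ₀) (f := μ)
    (g := fun s => μ s * (μ₀ s / μ s) ^ 2) (fun s _ => (hμpos s).le)
    (fun s _ => mul_nonneg (hμpos s).le (sq_nonneg _)) (fun s _ => by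
      have := (hμpos s).ne'
      exact le_of_eq (by field_simp))
  rwa [hμ₀, hμ, one_pow, one_mul] at h

/-- The exponential moment bound for a centred function of a reversible chain. -/
lemma sum_pathWeight_mul_exp_le [Fintype S] [DecidableEq S] {P : Matrix S S ℝ} {μ μ₀ h : S → ℝ} {g a : ℝ}
    (hP : P ∈ Matrix.rowStochastic ℝ S) (hμ : ∑ s, μ s = 1) (hμpos : ∀ s, 0 < μ s)
    (hrev : IsReversible P μ) (hg : 0 < g) (hgap : IsSpectralGap P g)
    (hμ₀ : ∀ s, 0 ≤ μ₀ s) (hμ₀sum : ∑ s, μ₀ s = 1)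
    (hmean : ∑ s, μ s * h s = 0) (ha : 0 ≤ a) (hh : ∀ s, |h s| ≤ a) (n : ℕ) :
    ∑ y : Fin (n + 1) → S, pathWeight μ₀ P y * Real.exp (∑ i : Fin n, h (y i.succ)) ≤
      3 * ratioNorm μ₀ μ * Real.exp (6 * a ^ 2 / g * n) := by
  have hr := one_le_ratioNorm hμ₀sum hμ hμpos
  have hexpn : Real.exp (6 * a ^ 2 / g * n) = Real.exp (6 * a ^ 2 / g) ^ n := by
    rw [mul_comm, Real.exp_nat_mul]
  -- At `a = g / 6` the exponents `a` and `6 a² / g` coincide; beyond it the trivial bound suffices.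
  rcases le_total a (g / 6) with hag | hag
  · set Λ := Real.exp (6 * a ^ 2 / g) with hΛ
    have hΛpos : 0 < Λ := Real.exp_pos _
    let M : Matrix S S ℝ := fun s t => P s t * Real.exp (h t)
    have hsum : ∑ y : Fin (n + 1) → S, pathWeight μ₀ P y * Real.exp (∑ i : Fin n, h (y i.succ)) =
        ∑ s, μ₀ s * (M ^ n).mulVec 1 s := by
      rw [← sum_path_prod]
      refine Finset.sum_congr rfl fun y _ => ?_
      rw [pathWeight, Real.exp_sum, mul_assoc, ← Finset.prod_mul_distrib]
    have hV : ∀ k : ℕ, ∑ s, μ s * Real.exp (h s) * (M ^ k).mulVec 1 s ^ 2 ≤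
        (Λ ^ 2) ^ k * Real.exp a := by
      intro k
      induction k with
      | zero =>
        rw [pow_zero, pow_zero, one_mul, Matrix.one_mulVec]
        calc ∑ s, μ s * Real.exp (h s) * (1 : S → ℝ) s ^ 2 ≤ ∑ s, μ s * Real.exp a :=
              Finset.sum_le_sum fun s _ => by
                rw [Pi.one_apply, one_pow, mul_one]
                exact mul_le_mul_of_nonneg_left
                  (Real.exp_le_exp.2 (abs_le.1 (hh s)).2) (hμpos s).le
          _ = Real.exp a := by rw [← Finset.sum_mul, hμ, one_mul]
      | succ k ih =>
        rw [pow_succ' M, ← Matrix.mulVec_mulVec]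
        refine (weightedNorm_tilted_le hP.1 hμpos hrev hΛpos (fun φ =>
          (quadraticForm_le hP hμ hμpos hrev hgap φ).trans
            (quadraticForm_tilted_le hμ hμpos hg hag hmean hh φ)) ((M ^ k).mulVec 1)).trans ?_
        rw [pow_succ' (Λ ^ 2), mul_assoc]
        exact mul_le_mul_of_nonneg_left ih (sq_nonneg _)
    have hcs : (∑ s, μ₀ s * (M ^ n).mulVec 1 s) ^ 2 ≤
        (∑ s, μ s * (μ₀ s / μ s) ^ 2 * Real.exp (-h s)) *
          ∑ s, μ s * Real.exp (h s) * (M ^ n).mulVec 1 s ^ 2 := by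
      refine Finset.sum_sq_le_sum_mul_sum_of_sq_le_mul _ (fun s _ => ?_) (fun s _ => ?_)
        (fun s _ => ?_)
      · have := hμpos s
        positivity
      · have := hμpos s
        positivity
      · have := (hμpos s).ne'
        rw [Real.exp_neg]
        exact le_of_eq (by field_simp)
    have hfirst : ∑ s, μ s * (μ₀ s / μ s) ^ 2 * Real.exp (-h s) ≤
        ratioNorm μ₀ μ ^ 2 * Real.exp a := by
      rw [ratioNorm, Real.sq_sqrt (Finset.sum_nonneg fun s _ =>
        mul_nonneg (hμpos s).le (sq_nonneg _)), Finset.sum_mul]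
      exact Finset.sum_le_sum fun s _ => mul_le_mul_of_nonneg_left
        (Real.exp_le_exp.2 (by linarith [(abs_le.1 (hh s)).1]))
        (mul_nonneg (hμpos s).le (sq_nonneg _))
    -- Changing between the weights `μ` and `μ e^h` costs `√(e^a)` at each end of the path, in total
    -- `e^a`, which the constant `3` covers.
    have hbound : (∑ s, μ₀ s * (M ^ n).mulVec 1 s) ^ 2 ≤
        (Real.exp a * ratioNorm μ₀ μ * Λ ^ n) ^ 2 := by
      calc _ ≤ (ratioNorm μ₀ μ ^ 2 * Real.exp a) * ((Λ ^ 2) ^ n * Real.exp a) :=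
            hcs.trans (mul_le_mul hfirst (hV n) (Finset.sum_nonneg fun s _ => by
              have := hμpos s
              positivity) (by positivity))
        _ = _ := by rw [← pow_mul, mul_comm 2 n, pow_mul]; ring
    have hexpa : Real.exp a ≤ 3 := by
      have hg2 := gap_le_two hP hgap
      calc Real.exp a ≤ Real.exp 1 := Real.exp_le_exp.2 (by linarith)
        _ ≤ 3 := by linarith [Real.exp_one_lt_d9]
    rw [hsum, hexpn]
    refine ((abs_le_of_sq_le_sq' hbound (by positivity)).2).trans ?_
    gcongr
  · have hle : a * n ≤ 6 * a ^ 2 / g * n := by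
      refine mul_le_mul_of_nonneg_right ?_ (Nat.cast_nonneg n)
      rw [le_div_iff₀ hg]
      nlinarith
    calc ∑ y : Fin (n + 1) → S, pathWeight μ₀ P y * Real.exp (∑ i : Fin n, h (y i.succ))
        ≤ ∑ y : Fin (n + 1) → S, pathWeight μ₀ P y * Real.exp (6 * a ^ 2 / g * n) := by
          refine Finset.sum_le_sum fun y _ => mul_le_mul_of_nonneg_left (Real.exp_le_exp.2 ?_)
            (pathWeight_nonneg hμ₀ hP.1 y)
          refine le_trans ?_ hle
          calc ∑ i : Fin n, h (y i.succ) ≤ ∑ _i : Fin n, a :=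
                Finset.sum_le_sum fun i _ => (abs_le.1 (hh _)).2
            _ = a * n := by simp [mul_comm]
      _ = Real.exp (6 * a ^ 2 / g * n) := by
          rw [← Finset.sum_mul, sum_pathWeight hμ₀sum hP, one_mul]
      _ ≤ 3 * ratioNorm μ₀ μ * Real.exp (6 * a ^ 2 / g * n) :=
          le_mul_of_one_le_left (Real.exp_pos _).le (by linarith)

end Paths

/-! ### Gaussian integration -/

section Gaussian

variable {V : Type*} [NormedAddCommGroup V] [InnerProductSpace ℝ V] {b : ℝ}

lemma exp_neg_mul_sq_norm_add_inner (hb : 0 < b) (w z : V) :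
    Real.exp (-b * ‖z‖ ^ 2 + inner ℝ w z) =
      Real.exp (‖w‖ ^ 2 / (4 * b)) * Real.exp (-b * ‖z - (1 / (2 * b)) • w‖ ^ 2) := by
  rw [← Real.exp_add, norm_sub_sq_real, inner_smul_right, norm_smul, real_inner_comm w z,
    Real.norm_of_nonneg (by positivity)]
  congr 1
  field_simp
  ring

variable [FiniteDimensional ℝ V] [MeasurableSpace V] [BorelSpace V]

lemma integrable_exp_neg_mul_sq_norm (hb : 0 < b) :
    Integrable fun z : V => Real.exp (-b * ‖z‖ ^ 2) := by
  refine Integrable.of_integral_ne_zero ?_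
  rw [GaussianFourier.integral_rexp_neg_mul_sq_norm hb]
  have := Real.pi_pos
  positivity

lemma integrable_exp_neg_mul_sq_norm_add_inner (hb : 0 < b) (w : V) :
    Integrable fun z : V => Real.exp (-b * ‖z‖ ^ 2 + inner ℝ w z) := by
  simp_rw [exp_neg_mul_sq_norm_add_inner hb]
  exact ((integrable_exp_neg_mul_sq_norm hb).comp_sub_right _).const_mul _

lemma integral_exp_neg_mul_sq_norm_add_inner (hb : 0 < b) (w : V) :
    ∫ z : V, Real.exp (-b * ‖z‖ ^ 2 + inner ℝ w z) =
      Real.exp (‖w‖ ^ 2 / (4 * b)) * (Real.pi / b) ^ (Module.finrank ℝ V / 2 : ℝ) := by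
  simp_rw [exp_neg_mul_sq_norm_add_inner hb]
  rw [integral_const_mul,
    integral_sub_right_eq_self (fun z : V => Real.exp (-b * ‖z‖ ^ 2)),
    GaussianFourier.integral_rexp_neg_mul_sq_norm hb]

/-- A sub-Gaussian bound for the Laplace transform of a finite measure on `V` bounds the
exponential moment of the squared norm. -/
lemma sum_mul_exp_sq_norm_le {ι : Type*} [Fintype ι] (p : ι → ℝ) (Y : ι → V)
    {C c : ℝ} (hc : 0 < c)
    (h : ∀ z : V, ∑ i, p i * Real.exp (inner ℝ (Y i) z) ≤ C * Real.exp (c * ‖z‖ ^ 2)) :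
    ∑ i, p i * Real.exp (‖Y i‖ ^ 2 / (8 * c)) ≤
      C * 2 ^ (Module.finrank ℝ V / 2 : ℝ) := by
  -- With the weight `exp (-2c ‖z‖²)` the right side stays integrable, and the two normalizations `π
  -- / c` and `π / (2c)` differ by the factor `2`.
  have hb : 0 < 2 * c := by linarith
  have hint := integral_mono
    (f := fun z : V => ∑ i, p i * Real.exp (-(2 * c) * ‖z‖ ^ 2 + inner ℝ (Y i) z))
    (g := fun z : V => C * Real.exp (-c * ‖z‖ ^ 2)) (μ := volume)
    (integrable_finsetSum _ fun i _ =>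
      (integrable_exp_neg_mul_sq_norm_add_inner hb (Y i)).const_mul _)
    ((integrable_exp_neg_mul_sq_norm hc).const_mul _)
    (fun z => by
      have hz := mul_le_mul_of_nonneg_left (h z) (Real.exp_pos (-(2 * c) * ‖z‖ ^ 2)).le
      calc ∑ i, p i * Real.exp (-(2 * c) * ‖z‖ ^ 2 + inner ℝ (Y i) z)
          = Real.exp (-(2 * c) * ‖z‖ ^ 2) * ∑ i, p i * Real.exp (inner ℝ (Y i) z) := by
            rw [Finset.mul_sum]
            exact Finset.sum_congr rfl fun i _ => by rw [Real.exp_add]; ring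
        _ ≤ _ := hz
        _ = C * Real.exp (-c * ‖z‖ ^ 2) := by
            rw [mul_left_comm, ← Real.exp_add]
            ring_nf)
  rw [integral_finsetSum _ fun i _ =>
      (integrable_exp_neg_mul_sq_norm_add_inner hb (Y i)).const_mul _, integral_const_mul,
    GaussianFourier.integral_rexp_neg_mul_sq_norm hc] at hint
  simp_rw [integral_const_mul, integral_exp_neg_mul_sq_norm_add_inner hb] at hint
  have hpi : Real.pi / c = 2 * (Real.pi / (2 * c)) := by
    field_simp
  have hq : 0 < Real.pi / (2 * c) := div_pos Real.pi_pos hb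
  rw [hpi, Real.mul_rpow zero_le_two hq.le, ← mul_assoc C] at hint
  refine le_of_mul_le_mul_right (le_trans (le_of_eq ?_) hint) (Real.rpow_pos_of_pos hq _)
  rw [Finset.sum_mul]
  refine Finset.sum_congr rfl fun i _ => ?_
  rw [mul_assoc]
  congr 4
  ring

end Gaussian

/-! ### From the chain to the deviation bound -/

section Chain

variable {S : Type*} [MeasurableSpace S]
  {Ω : Type*} [MeasurableSpace Ω] {Pr : Measure Ω} {P : Matrix S S ℝ} {μ₀ : S → ℝ}
  {X : ℕ → Ω → S}

lemma IsMarkovChain.real_path (hX : IsMarkovChain Pr X μ₀ P) (n : ℕ) (x : ℕ → S) :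
    Pr.real {ω | ∀ i ≤ n, X i ω = x i} =
      μ₀ (x 0) * ∏ i ∈ Finset.range n, P (x i) (x (i + 1)) := by
  induction n with
  | zero => simpa using hX.initial (x 0)
  | succ n ih => rw [hX.step, ih, Finset.prod_range_succ, mul_assoc]

lemma IsMarkovChain.real_preimage_path (hX : IsMarkovChain Pr X μ₀ P) {n : ℕ}
    (y : Fin (n + 1) → S) :
    Pr.real ((fun ω (i : Fin (n + 1)) => X i ω) ⁻¹' {y}) = pathWeight μ₀ P y := by
  have hval : ∀ i : Fin (n + 1), Fin.ofNat (n + 1) (i : ℕ) = i := fun i => by simp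
  -- `Fin.ofNat` extends `y` periodically to `ℕ`; only the values up to `n` matter.
  have h := hX.real_path n (fun i => y (Fin.ofNat (n + 1) i))
  rw [Finset.prod_range] at h
  have hset : (fun ω (i : Fin (n + 1)) => X i ω) ⁻¹' {y} =
      {ω | ∀ i ≤ n, X i ω = y (Fin.ofNat (n + 1) i)} := by
    ext ω
    simp only [Set.mem_preimage, Set.mem_singleton_iff, Set.mem_ofPred_eq, funext_iff]
    constructor
    · intro hy i hi
      rw [hval ⟨i, Nat.lt_succ_of_le hi⟩]
      exact hy ⟨i, Nat.lt_succ_of_le hi⟩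
    · intro hy i
      rw [hy i (Nat.lt_succ_iff.1 i.2), hval]
  rw [hset, h, pathWeight]
  congr 1
  refine Finset.prod_congr rfl fun i _ => ?_
  rw [← Fin.val_succ, hval, ← Fin.val_castSucc i, hval]

variable [MeasurableSingletonClass S]

lemma IsMarkovChain.sum_initial [Fintype S] [IsProbabilityMeasure Pr] (hX : IsMarkovChain Pr X μ₀ P) :
    ∑ s, μ₀ s = 1 := by
  have h := sum_measureReal_preimage_singleton (μ := Pr) Finset.univ (f := X 0)
    (fun s _ => hX.measurable 0 (measurableSet_singleton s))
  rw [Finset.coe_univ, Set.preimage_univ, probReal_univ] at h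
  rw [← h]
  exact Finset.sum_congr rfl fun s _ => (hX.initial s).symm

lemma IsMarkovChain.real_preimage [IsProbabilityMeasure Pr] (hX : IsMarkovChain Pr X μ₀ P)
    {n : ℕ} (A : Finset (Fin (n + 1) → S)) :
    Pr.real ((fun ω (i : Fin (n + 1)) => X i ω) ⁻¹' A) = ∑ y ∈ A, pathWeight μ₀ P y := by
  have hmeas : Measurable fun ω (i : Fin (n + 1)) => X i ω :=
    measurable_pi_lambda _ fun i => hX.measurable i
  rw [← sum_measureReal_preimage_singleton (μ := Pr) A
    (fun y _ => hmeas (measurableSet_singleton y))]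
  exact Finset.sum_congr rfl fun y _ => hX.real_preimage_path y

variable [Fintype S] [DecidableEq S]
  {E : Type*} [NormedAddCommGroup E] [InnerProductSpace ℝ E] [FiniteDimensional ℝ E]

/-- The deviation inequality with the constant `6 L ^ 2 / g`. -/
lemma IsMarkovChain.real_norm_sum_ge_le [IsProbabilityMeasure Pr]
    (hX : IsMarkovChain Pr X μ₀ P) (hP : P ∈ Matrix.rowStochastic ℝ S) {μ : S → ℝ}
    (hμ : ∑ s, μ s = 1) (hμpos : ∀ s, 0 < μ s) (hrev : IsReversible P μ) {g : ℝ} (hg : 0 < g)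
    (hgap : IsSpectralGap P g) {f : S → E} (hmean : ∑ s, μ s • f s = 0) {L : ℝ} (hL : 0 < L)
    (hf : ∀ s, ‖f s‖ ≤ L) {ε : ℝ} (hε : 0 < ε) {N : ℕ} (hN : 0 < N) :
    Pr.real {ω | ε * N ≤ ‖∑ t ∈ Finset.Icc 1 N, f (X t ω)‖} ≤
      3 * ratioNorm μ₀ μ * (2 : ℝ) ^ ((Module.finrank ℝ E : ℝ) / 2) *
        Real.exp (-(1 / (8 * (6 * L ^ 2 / g))) * ε ^ 2 * N) := by
  let _ : MeasurableSpace E := borel E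
  have _ : BorelSpace E := ⟨rfl⟩
  set K : ℝ := 6 * L ^ 2 / g with hK
  have hKpos : 0 < K := by positivity
  have hNpos : (0 : ℝ) < N := Nat.cast_pos.2 hN
  have hμ₀ : ∀ s, 0 ≤ μ₀ s := fun s => hX.initial s ▸ measureReal_nonneg
  let Y : (Fin (N + 1) → S) → E := fun y => ∑ i : Fin N, f (y i.succ)
  have hY : ∀ ω, ∑ t ∈ Finset.Icc 1 N, f (X t ω) = Y fun i => X i ω := fun ω => by
    rw [← Finset.Ico_add_one_right_eq_Icc, Finset.sum_Ico_eq_sum_range, Finset.sum_range]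
    exact Finset.sum_congr rfl fun i _ => by simp [add_comm]
  have hmgf : ∀ z : E, ∑ y, pathWeight μ₀ P y * Real.exp (inner ℝ (Y y) z) ≤
      3 * ratioNorm μ₀ μ * Real.exp (K * N * ‖z‖ ^ 2) := fun z => by
    have h := sum_pathWeight_mul_exp_le (h := fun s => inner ℝ (f s) z) (a := L * ‖z‖)
      hP hμ hμpos hrev hg hgap hμ₀ hX.sum_initial
      (by simp_rw [← real_inner_smul_left]; rw [← sum_inner, hmean, inner_zero_left])
      (by positivity)
      (fun s => (abs_real_inner_le_norm _ _).trans
        (mul_le_mul_of_nonneg_right (hf s) (norm_nonneg z))) N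
    simp only [Y, sum_inner]
    refine h.trans_eq ?_
    rw [hK]
    congr 2
    ring
  have hmoment := sum_mul_exp_sq_norm_le (pathWeight μ₀ P) Y (mul_pos hKpos hNpos) hmgf
  classical
  let A : Finset (Fin (N + 1) → S) := {y | ε * N ≤ ‖Y y‖}
  have hset : {ω | ε * N ≤ ‖∑ t ∈ Finset.Icc 1 N, f (X t ω)‖} =
      (fun ω (i : Fin (N + 1)) => X i ω) ⁻¹' A := by
    ext ω
    simp [A, hY]
  -- Markov's inequality for `exp (‖Y‖² / (8 K N))`, which is at least `exp (ε² N / (8 K))` on the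
  -- event.
  rw [hset, hX.real_preimage, neg_mul, neg_mul, Real.exp_neg, ← div_eq_mul_inv,
    le_div_iff₀ (Real.exp_pos _), Finset.sum_mul]
  refine le_trans ?_ hmoment
  refine (Finset.sum_le_sum fun y hy => ?_).trans
    (Finset.sum_le_sum_of_subset_of_nonneg (Finset.subset_univ A) fun y _ _ =>
      mul_nonneg (pathWeight_nonneg hμ₀ hP.1 y) (Real.exp_pos _).le)
  refine mul_le_mul_of_nonneg_left (Real.exp_le_exp.2 ?_) (pathWeight_nonneg hμ₀ hP.1 y)
  have hy' : ε * N ≤ ‖Y y‖ := by simpa [A] using hy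
  rw [le_div_iff₀ (by positivity)]
  calc 1 / (8 * K) * ε ^ 2 * N * (8 * (K * N)) = (ε * N) ^ 2 := by
        field_simp
    _ ≤ ‖Y y‖ ^ 2 := pow_le_pow_left₀ (by positivity) hy' 2

end Chain

/-! ### Comparison of constants -/

section Constants

/-- For `y = √(1 + x)`, the inequality `u ≤ sinh u` at `u = log y` reads `log (1 + x) ≤ y - 1 / y =
x / y`. -/
lemma log_one_add_sq_le {x : ℝ} (hx : 0 ≤ x) : Real.log (1 + x) ^ 2 ≤ x ^ 2 / (1 + x) := by
  have h1 : 0 < 1 + x := by linarith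
  set y := √(1 + x) with hy
  have hypos : 0 < y := Real.sqrt_pos.2 h1
  have hy1 : 1 ≤ y := Real.one_le_sqrt.2 (by linarith)
  have hysq : 1 + x = y ^ 2 := (Real.sq_sqrt h1.le).symm
  have hlog : Real.log (1 + x) ≤ x / y := by
    have hs := Real.self_le_sinh_iff.2 (Real.log_nonneg hy1)
    rw [Real.sinh_eq, Real.exp_neg, Real.exp_log hypos] at hs
    have hx' : x / y = y - y⁻¹ := by
      rw [eq_sub_of_add_eq' hysq]
      field_simp
    rw [hx', hysq, Real.log_pow]
    push_cast
    linarith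
  have hnn : 0 ≤ Real.log (1 + x) := Real.log_nonneg (by linarith)
  calc Real.log (1 + x) ^ 2 ≤ (x / y) ^ 2 := pow_le_pow_left₀ hnn hlog 2
    _ = x ^ 2 / (1 + x) := by rw [div_pow, ← hysq]

/-- Both constants of the theorem dominate `6 L ^ 2 / g`. -/
lemma six_mul_sq_div_le {g σ L : ℝ} (hg : 0 < g) (hg2 : g ≤ 2) :
    6 * L ^ 2 / g ≤ σ ^ 2 * (1 / 2 + 1 / g) +
        L ^ 2 * (192 / 125) * (g / Real.log (1 + g / 2) ^ 2) ∧
      6 * L ^ 2 / g ≤ σ ^ 2 * (1 / 2 + 1 / g) +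
        L ^ 2 * (192 / (125 * Real.log (1 + g / 2) ^ 2)) := by
  have hlog : 0 < Real.log (1 + g / 2) := Real.log_pos (by linarith)
  have hsq := log_one_add_sq_le (x := g / 2) (by linarith)
  have hsq' : Real.log (1 + g / 2) ^ 2 * (4 * (1 + g / 2)) ≤ g ^ 2 := by
    rw [le_div_iff₀ (by linarith)] at hsq
    linarith
  set l := Real.log (1 + g / 2) ^ 2 with hl
  have hlpos : 0 < l := by positivity
  have hσ : 0 ≤ σ ^ 2 * (1 / 2 + 1 / g) := by positivity
  -- The case `r = g` belongs to `k`, where `4 * 192 / 125 = 6.144` leaves room for `6`. The case `r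
  -- = 1` belongs to `k'` and needs `g ≤ 2`.
  have hmain : ∀ r : ℝ, 125 * 6 * l ≤ 192 * g * r →
      6 * L ^ 2 / g ≤ L ^ 2 * (192 / 125) * (r / l) := fun r hr => by
    rw [div_le_iff₀ hg]
    have : L ^ 2 * (192 / 125) * (r / l) * g = L ^ 2 * (192 * g * r / (125 * l)) := by
      field_simp
    rw [this, mul_comm]
    refine mul_le_mul_of_nonneg_left ?_ (sq_nonneg L)
    rw [le_div_iff₀ (by positivity)]
    linarith
  constructor
  · have := hmain g (by nlinarith)
    linarith
  · have := hmain 1 (by nlinarith)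
    have he : L ^ 2 * (192 / (125 * l)) = L ^ 2 * (192 / 125) * (1 / l) := by
      field_simp
    linarith

end Constants

end ReversibleChain

theorem theorem1
    {S : Type*} [Fintype S] [DecidableEq S] [MeasurableSpace S] [MeasurableSingletonClass S]
    {E : Type*} [NormedAddCommGroup E] [InnerProductSpace ℝ E] [FiniteDimensional ℝ E]
    {Ω : Type*} [MeasurableSpace Ω] (Pr : Measure Ω) [IsProbabilityMeasure Pr]
    (m : ℕ) (hm : Module.finrank ℝ E = m)
    (P : Matrix S S ℝ) (hP : P ∈ Matrix.rowStochastic ℝ S)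
    (μ : S → ℝ) (hμ : μ ∈ stdSimplex ℝ S) (hμpos : ∀ s, 0 < μ s)
    (hrev : ReversibleChain.IsReversible P μ)
    (g : ℝ) (hg : 0 < g) (hgap : ReversibleChain.IsSpectralGap P g)
    (f : S → E) (hmean : ∑ s, μ s • f s = 0)
    (L : ℝ) (hL : ReversibleChain.supNorm f ≤ L)
    (σ : ℝ) (hσ : ReversibleChain.principalVariance μ f ≤ σ ^ 2)
    (μ₀ : S → ℝ) (X : ℕ → Ω → S) (hX : ReversibleChain.IsMarkovChain Pr X μ₀ P)
    (k k' : ℝ)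
    (hk : k = σ ^ 2 * (1 / 2 + 1 / g) + L ^ 2 * (192 / 125) * (g / Real.log (1 + g / 2) ^ 2))
    (hk' : k' = σ ^ 2 * (1 / 2 + 1 / g) + L ^ 2 * (192 / (125 * Real.log (1 + g / 2) ^ 2)))
    (ε : ℝ) (hε : 0 < ε) (N : ℕ) :
    Pr.real {ω | ε * N ≤ ‖∑ t ∈ Finset.Icc 1 N, f (X t ω)‖} ≤
        3 * ReversibleChain.ratioNorm μ₀ μ * (2 : ℝ) ^ ((m : ℝ) / 2) *
          Real.exp (-(1 / (8 * k)) * ε ^ 2 * N) ∧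
      Pr.real {ω | ε * N ≤ ‖∑ t ∈ Finset.Icc 1 N, f (X t ω)‖} ≤
        3 * ReversibleChain.ratioNorm μ₀ μ * (2 : ℝ) ^ ((m : ℝ) / 2) *
          Real.exp (-(1 / (8 * k')) * ε ^ 2 * N) := by
  have hf : ∀ s, ‖f s‖ ≤ L := fun s =>
    (le_ciSup (Set.finite_range fun s => ‖f s‖).bddAbove s).trans hL
  have hL0 : 0 ≤ L := (Real.iSup_nonneg fun s => norm_nonneg (f s)).trans hL
  have hr := ReversibleChain.one_le_ratioNorm hX.sum_initial hμ.2 hμpos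
  have hkk := ReversibleChain.six_mul_sq_div_le (σ := σ) (L := L) hg
    (ReversibleChain.gap_le_two hP hgap)
  rw [← hk, ← hk'] at hkk
  have key : ∀ c : ℝ, 6 * L ^ 2 / g ≤ c →
      Pr.real {ω | ε * N ≤ ‖∑ t ∈ Finset.Icc 1 N, f (X t ω)‖} ≤
        3 * ReversibleChain.ratioNorm μ₀ μ * (2 : ℝ) ^ ((m : ℝ) / 2) *
          Real.exp (-(1 / (8 * c)) * ε ^ 2 * N) := by
    intro c hc
    rcases Nat.eq_zero_or_pos N with rfl | hN
    -- For `N = 0` the event is certain, but the right side is at least `3`.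
    · have h2 : (1 : ℝ) ≤ 2 ^ ((m : ℝ) / 2) :=
        Real.one_le_rpow one_le_two (by positivity)
      rw [Nat.cast_zero, mul_zero, mul_zero, Real.exp_zero, mul_one]
      exact measureReal_le_one.trans (one_le_mul_of_one_le_of_one_le (by linarith) h2)
    · have hNpos : (0 : ℝ) < N := Nat.cast_pos.2 hN
      rcases hL0.eq_or_lt with hL' | hL'
      -- For `L = 0` the event is empty, so the value of `1 / (8 * c)` at a possible `c = 0` is
      -- harmless.
      · have hf0 : ∀ s, f s = 0 := fun s => norm_le_zero_iff.1 (hL' ▸ hf s)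
        have hempty : {ω | ε * N ≤ ‖∑ t ∈ Finset.Icc 1 N, f (X t ω)‖} = ∅ := by
          ext ω
          have : 0 < ε * N := mul_pos hε hNpos
          simpa [hf0] using this
        rw [hempty, measureReal_empty]
        positivity
      · have hmain := hX.real_norm_sum_ge_le hP hμ.2 hμpos hrev hg hgap hmean hL' hf hε hN
        rw [hm] at hmain
        have hpos : 0 < 6 * L ^ 2 / g := by positivity
        refine hmain.trans (mul_le_mul_of_nonneg_left (Real.exp_le_exp.2 ?_) (by positivity))
        rw [mul_assoc, mul_assoc]
        refine mul_le_mul_of_nonneg_right (neg_le_neg ?_) (by positivity)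
        gcongr
  exact ⟨key k hkk.1, key k' hkk.2⟩
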